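/- Let $\Bbbk$ be a field of characteristic different from $2$ and let $\mathcal{Q}\mathit{Sym}$ be the graded connected Hopf algebra of quasi-symmetric functions over $\Bbbk$ (power series of bounded degree in $x_1,x_2,\ldots$ such that for all positive $a_1,\ldots,a_k$ and all $i_1<\cdots<i_k$ the coefficient of $x_{i_1}^{a_1}\cdots x_{i_k}^{a_k}$ equals that of $x_1^{a_1}\cdots x_k^{a_k}$). It has the basis of monomial functions $M_\alpha=\sum_{i_1<\cdots<i_k}x_{i_1}^{a_1}\cdots x_{i_k}^{a_k}$, indexed by compositions $\alpha=(a_1,\ldots,a_k)$, $a_j\ge 1$, including the empty composition, with $M_{(\,)}=1$. Its coproduct and counit are $\Delta(M_\alpha)=\sum_{i=0}^k M_{(a_1,\ldots,a_i)}\otimes M_{(a_{i+1},\ldots,a_k)}$ and $\epsilon(M_\alpha)=\delta_{\alpha,(\,)}$. Linear functionals $\mathcal{Q}\mathit{Sym}\to\Bbbk$ are multiplied by convolution, $\rho\psi=m\circ(\rho\otimes\psi)\circ\Delta$, where $m$ is the multiplication of $\Bbbk$; the unit is $\epsilon$. For a functional $\varphi$ let $\bar\varphi(h)=(-1)^n\varphi(h)$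 for $h$ homogeneous of degree $n$; $\varphi$ is even if $\bar\varphi=\varphi$, and odd if it is invertible under convolution and $\bar\varphi=\varphi^{-1}$. The universal character $\zeta:\mathcal{Q}\mathit{Sym}\to\Bbbk$ is given by $\zeta(M_\alpha)=1$ if $\alpha=(n)$ or $\alpha=(\,)$, and $\zeta(M_\alpha)=0$ otherwise. There are unique linear functionals $\zeta_+,\zeta_-$ with $\zeta_+(1)=\zeta_-(1)=1$, $\zeta_+$ even, $\zeta_-$ odd and $\zeta=\zeta_+\zeta_-$; they are characters, i.e. morphisms of algebras. Let $C(m,n)=\frac{(2m)!\,(2n)!}{m!\,(m+n)!\,n!}$, and let $k_e(\alpha)$ and $k_o(\alpha)$ be the numbers of even and of odd parts of $\alpha$. If $\alpha=(a_1,\ldots,a_k)$ is a composition of a positive integer $n$, then $$\zeta_-(M_\alpha)=\begin{cases}\dfrac{(-1)^{k_e(\alpha)}}{2^{2\lfloor k_o(\alpha)/2\rfloor}}\,C\bigl(0,\lfloor k_o(\alpha)/2\rfloor\bigr)&\text{if }a_k\text{ is odd},\\[2ex] 0&\text{if }a_k\text{ is even},\end{cases}$$ $$\zeta_+(M_\alpha)=\begin{cases}\dfrac{(-1)^{k_e(\alpha)+1}}{2^{k_o(\alpha)}}\,C\bigl(1,k_o(\alpha)/2-1\bigr)&\text{if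 }a_1\text{ and }a_k\text{ are odd and }n\text{ is even},\\[2ex] 1&\text{if }\alpha=(n)\text{ and }n\text{ is even},\\ 0&\text{otherwise.}\end{cases}$$ Moreover $\zeta_-(1)=\zeta_+(1)=1$. -/

import Mathlib

namespace QSymm

/-! ### Quasi-symmetric functions

Variables are `x_0, x_1, x_2, …`; a composition is a finite list of positive integers. -/

/-- The exponent vector of the monomial `∏ⱼ x_{i j} ^ (a j)`. -/
noncomputable def exps {r : ℕ} (i a : Fin r → ℕ) : ℕ →₀ ℕ := ∑ j, Finsupp.single (i j) (a j)

/-- `f` is quasi-symmetric: for strictly increasing `i` and `j`, the coefficients of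
`x_{i 0}^{a 0} ⋯ x_{i (r-1)}^{a (r-1)}` and of `x_{j 0}^{a 0} ⋯ x_{j (r-1)}^{a (r-1)}` agree.
(Zero exponents may be dropped, so allowing them changes nothing.) -/
def IsQuasisymmetric {k : Type*} [Field k] (f : MvPowerSeries ℕ k) : Prop :=
  ∀ (r : ℕ) (a i j : Fin r → ℕ), StrictMono i → StrictMono j →
    MvPowerSeries.coeff (exps i a) f = MvPowerSeries.coeff (exps j a) f

/-- `f` has bounded degree. -/
def IsBounded {k : Type*} [Field k] (f : MvPowerSeries ℕ k) : Prop :=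
  ∃ N : ℕ, ∀ d : ℕ →₀ ℕ, MvPowerSeries.coeff d f ≠ 0 → d.degree ≤ N

theorem exps_apply_of_mem {r : ℕ} {i : Fin r → ℕ} (hi : Function.Injective i) (a : Fin r → ℕ)
    (s : Fin r) : exps i a (i s) = a s := by
  simp [exps, Finsupp.finsetSum_apply, Finsupp.single_apply, hi.eq_iff]

theorem exps_apply_of_notMem {r : ℕ} {i : Fin r → ℕ} (a : Fin r → ℕ) {n : ℕ}
    (h : ∀ s, i s ≠ n) : exps i a n = 0 := by
  simp [exps, Finsupp.finsetSum_apply, h]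

theorem exps_comp_self {r : ℕ} {i : Fin r → ℕ} (hi : Function.Injective i) (d : ℕ →₀ ℕ)
    (h : ∀ n, (∀ s, i s ≠ n) → d n = 0) : exps i (fun s => d (i s)) = d := by
  ext n
  by_cases hn : ∃ s, i s = n
  · obtain ⟨s, rfl⟩ := hn
    rw [exps_apply_of_mem hi]
  · push Not at hn
    rw [exps_apply_of_notMem _ hn, h n hn]

theorem degree_exps {r : ℕ} (i a : Fin r → ℕ) : (exps i a).degree = ∑ s, a s := by
  simp [exps, map_sum]

theorem exps_add {r : ℕ} (i a b : Fin r → ℕ) : exps i (a + b) = exps i a + exps i b := by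
  simp [exps, Finset.sum_add_distrib]

theorem coeff_mul_exps {k : Type*} [Field k] (f g : MvPowerSeries ℕ k) {r : ℕ}
    {i : Fin r → ℕ} (hi : Function.Injective i) (a : Fin r →₀ ℕ) :
    MvPowerSeries.coeff (exps i a) (f * g) =
      ∑ p ∈ Finset.HasAntidiagonal.antidiagonal a,
        MvPowerSeries.coeff (exps i p.1) f * MvPowerSeries.coeff (exps i p.2) g := by
  classical
  rw [MvPowerSeries.coeff_mul]
  symm
  refine Finset.sum_bij (fun p _ => (exps i p.1, exps i p.2)) ?_ ?_ ?_ ?_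
  · rintro ⟨u, v⟩ h
    simp only [Finset.HasAntidiagonal.mem_antidiagonal] at h ⊢
    rw [← exps_add, ← h]
    rfl
  · rintro ⟨u, v⟩ _ ⟨u', v'⟩ _ h
    simp only [Prod.mk.injEq] at h ⊢
    constructor <;> ext s
    · rw [← exps_apply_of_mem hi u s, h.1, exps_apply_of_mem hi]
    · rw [← exps_apply_of_mem hi v s, h.2, exps_apply_of_mem hi]
  · rintro ⟨u, v⟩ h
    simp only [Finset.HasAntidiagonal.mem_antidiagonal] at h
    have h0 : ∀ n, u n + v n = exps i a n := fun n => by rw [← h]; rfl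
    have hu : ∀ n, (∀ s, i s ≠ n) → u n = 0 := fun n hn => by
      have := h0 n; rw [exps_apply_of_notMem _ hn] at this; omega
    have hv : ∀ n, (∀ s, i s ≠ n) → v n = 0 := fun n hn => by
      have := h0 n; rw [exps_apply_of_notMem _ hn] at this; omega
    refine ⟨(Finsupp.equivFunOnFinite.symm fun s => u (i s),
      Finsupp.equivFunOnFinite.symm fun s => v (i s)), ?_, ?_⟩
    · simp only [Finset.HasAntidiagonal.mem_antidiagonal]
      ext s
      simp [h0, exps_apply_of_mem hi]
    · simp only [Finsupp.coe_equivFunOnFinite_symm, Prod.mk.injEq]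
      exact ⟨exps_comp_self hi u hu, exps_comp_self hi v hv⟩
  · rintro ⟨u, v⟩ _
    rfl

theorem IsQuasisymmetric.mul {k : Type*} [Field k] {f g : MvPowerSeries ℕ k}
    (hf : IsQuasisymmetric f) (hg : IsQuasisymmetric g) : IsQuasisymmetric (f * g) := by
  intro r a i j hi hj
  have hi' := coeff_mul_exps f g hi.injective (Finsupp.equivFunOnFinite.symm a)
  have hj' := coeff_mul_exps f g hj.injective (Finsupp.equivFunOnFinite.symm a)
  simp only [Finsupp.coe_equivFunOnFinite_symm] at hi' hj'
  rw [hi', hj']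
  exact Finset.sum_congr rfl fun p _ => by rw [hf r _ i j hi hj, hg r _ i j hi hj]

theorem IsBounded.mul {k : Type*} [Field k] {f g : MvPowerSeries ℕ k}
    (hf : IsBounded f) (hg : IsBounded g) : IsBounded (f * g) := by
  classical
  obtain ⟨N, hN⟩ := hf
  obtain ⟨N', hN'⟩ := hg
  refine ⟨N + N', fun d hd => ?_⟩
  rw [MvPowerSeries.coeff_mul] at hd
  obtain ⟨p, hp, hne⟩ := Finset.exists_ne_zero_of_sum_ne_zero hd
  rw [Finset.HasAntidiagonal.mem_antidiagonal] at hp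
  rw [← hp, map_add]
  exact add_le_add (hN _ (left_ne_zero_of_mul hne)) (hN' _ (right_ne_zero_of_mul hne))

/-- The algebra of quasi-symmetric functions over `k`: quasi-symmetric power series of bounded
degree in countably many variables. -/
noncomputable def QSym (k : Type*) [Field k] : Subalgebra k (MvPowerSeries ℕ k) where
  carrier := {f | IsQuasisymmetric f ∧ IsBounded f}
  mul_mem' hf hg := ⟨hf.1.mul hg.1, hf.2.mul hg.2⟩
  add_mem' := by
    rintro f g ⟨hf, N, hN⟩ ⟨hg, N', hN'⟩
    refine ⟨fun r a i j hi hj => by rw [map_add, map_add, hf r a i j hi hj, hg r a i j hi hj],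
      max N N', fun d hd => ?_⟩
    by_cases h : MvPowerSeries.coeff d f = 0
    · rw [map_add, h, zero_add] at hd
      exact (hN' d hd).trans (le_max_right _ _)
    · exact (hN d h).trans (le_max_left _ _)
  algebraMap_mem' c := by
    classical
    have key : ∀ d : ℕ →₀ ℕ, MvPowerSeries.coeff d (algebraMap k (MvPowerSeries ℕ k) c) =
        if d.degree = 0 then c else 0 := fun d => by
      simp [MvPowerSeries.algebraMap_apply, MvPowerSeries.coeff_C, Finsupp.degree_eq_zero_iff]
    refine ⟨fun r a i j _ _ => by rw [key, key, degree_exps, degree_exps], 0, fun d hd => ?_⟩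
    rw [key] at hd
    by_contra h
    exact hd (if_neg fun h' => h h'.le)

/-! ### The monomial basis -/

/-- The parts of a composition, as a function on `Fin`. -/
def parts (α : List ℕ+) : Fin α.length → ℕ := fun s => (α.get s : ℕ)

open Classical in
/-- The power series `∑_{i_1 < ⋯ < i_k} x_{i_1}^{a_1} ⋯ x_{i_k}^{a_k}`, `α = (a_1, …, a_k)`. -/
noncomputable def monomialSeries (k : Type*) [Field k] (α : List ℕ+) : MvPowerSeries ℕ k :=
  fun d => if ∃ i : Fin α.length → ℕ, StrictMono i ∧ d = exps i (parts α) then 1 else 0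

/-- The list of the non-zero exponents of `d`, in the order of the variables. -/
noncomputable def flat (d : ℕ →₀ ℕ) : List ℕ+ := d.support.sort.map fun n => (d n).toPNat'

theorem flat_exps {r : ℕ} {i : Fin r → ℕ} (hi : StrictMono i) (a : Fin r → ℕ) :
    flat (exps i a) = ((List.finRange r).filter fun s => a s ≠ 0).map fun s => (a s).toPNat' := by
  have hs : (exps i a).support.sort = ((List.finRange r).filter fun s => a s ≠ 0).map i := by
    have hsort : (((List.finRange r).filter fun s => a s ≠ 0).map i).Pairwise (· < ·) := by
      rw [List.pairwise_map]
      exact ((List.pairwise_lt_finRange r).filter _).imp fun h => hi h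
    have h2 : (((List.finRange r).filter fun s => a s ≠ 0).map i).toFinset
        = (exps i a).support := by
      ext n
      simp only [List.mem_toFinset, List.mem_map, List.mem_filter, List.mem_finRange, true_and,
        decide_eq_true_eq, Finsupp.mem_support_iff]
      constructor
      · rintro ⟨s, hs, rfl⟩
        rwa [exps_apply_of_mem hi.injective]
      · intro h
        by_contra hcon
        apply h
        by_cases hn : ∃ s, i s = n
        · obtain ⟨s, rfl⟩ := hn
          rw [exps_apply_of_mem hi.injective]
          by_contra h'
          exact hcon ⟨s, h', rfl⟩
        · push Not at hn
          exact exps_apply_of_notMem _ hn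
    rw [← h2]
    exact (List.toFinset_sort (· ≤ ·) (hsort.imp fun h => h.ne)).2 (hsort.imp fun h => h.le)
  rw [flat, hs, List.map_map]
  refine List.map_congr_left fun s _ => ?_
  simp [exps_apply_of_mem hi.injective]

theorem flat_exps_parts (α : List ℕ+) {i : Fin α.length → ℕ} (hi : StrictMono i) :
    flat (exps i (parts α)) = α := by
  rw [flat_exps hi, List.filter_eq_self.2 (by simp [parts])]
  conv_rhs => rw [← List.map_get_finRange α]
  simp [parts]

theorem exists_eq_exps (d : ℕ →₀ ℕ) :
    ∃ i : Fin (flat d).length → ℕ, StrictMono i ∧ d = exps i (parts (flat d)) := by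
  have hl : d.support.card = (flat d).length := by simp [flat]
  have hi := (d.support.orderEmbOfFin hl).strictMono
  refine ⟨d.support.orderEmbOfFin hl, hi, ?_⟩
  have hp : parts (flat d) = fun s => d (d.support.orderEmbOfFin hl s) := by
    funext s
    have hm := Finset.orderEmbOfFin_mem d.support hl s
    rw [Finset.orderEmbOfFin_apply] at hm ⊢
    rw [Finsupp.mem_support_iff] at hm
    have hs : (s : ℕ) < d.support.sort.length := by
      rw [Finset.length_sort, hl]; exact s.2
    have hg : (flat d).get s = (d (d.support.sort[(s : ℕ)]'hs)).toPNat' := by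
      rw [List.get_eq_getElem]
      exact List.getElem_map _
    rw [parts, hg]
    exact PNat.toPNat'_coe (Nat.pos_of_ne_zero hm)
  rw [hp]
  refine (exps_comp_self hi.injective d fun n hn => ?_).symm
  by_contra h
  have : n ∈ Set.range (d.support.orderEmbOfFin hl) := by
    rw [Finset.range_orderEmbOfFin]; simpa using h
  obtain ⟨s, hs⟩ := this
  exact hn s hs

theorem coeff_monomialSeries (k : Type*) [Field k] (α : List ℕ+) (d : ℕ →₀ ℕ) :
    MvPowerSeries.coeff d (monomialSeries k α) = if flat d = α then 1 else 0 := by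
  rw [MvPowerSeries.coeff_apply, monomialSeries]
  congr 1
  refine propext ⟨?_, ?_⟩
  · rintro ⟨i, hi, rfl⟩
    exact flat_exps_parts α hi
  · rintro rfl
    exact exists_eq_exps d

/-- The size `a_1 + ⋯ + a_k` of a composition. -/
def size (α : List ℕ+) : ℕ := (α.map PNat.val).sum

theorem sum_parts (α : List ℕ+) : ∑ s, parts α s = size α := by
  rw [size, ← Fin.sum_univ_fun_getElem]
  simp [parts]

theorem degree_eq_size_flat (d : ℕ →₀ ℕ) : d.degree = size (flat d) := by
  obtain ⟨i, _, h⟩ := exists_eq_exps d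
  conv_lhs => rw [h]
  rw [degree_exps, sum_parts]

/-- The monomial quasi-symmetric function `M_α`. -/
noncomputable def M (k : Type*) [Field k] (α : List ℕ+) : QSym k :=
  ⟨monomialSeries k α, fun r a i j hi hj => by
      rw [coeff_monomialSeries, coeff_monomialSeries, flat_exps hi, flat_exps hj],
    size α, fun d hd => by
      rw [coeff_monomialSeries] at hd
      rw [degree_eq_size_flat]
      by_contra h
      exact hd (if_neg fun h' => h (by rw [h']))⟩

theorem coeff_M (k : Type*) [Field k] (α : List ℕ+) (d : ℕ →₀ ℕ) :
    MvPowerSeries.coeff d (M k α : MvPowerSeries ℕ k) = if flat d = α then 1 else 0 :=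
  coeff_monomialSeries k α d

/-- The coefficient of `x_0^{a_1} ⋯ x_{k-1}^{a_k}` in `f`, `α = (a_1, …, a_k)`. -/
noncomputable def coord {k : Type*} [Field k] (f : QSym k) (α : List ℕ+) : k :=
  MvPowerSeries.coeff (exps (fun s : Fin α.length => (s : ℕ)) (parts α)) (f : MvPowerSeries ℕ k)

theorem coeff_eq_coord {k : Type*} [Field k] (f : QSym k) (d : ℕ →₀ ℕ) :
    MvPowerSeries.coeff d (f : MvPowerSeries ℕ k) = coord f (flat d) := by
  obtain ⟨i, hi, h⟩ := exists_eq_exps d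
  conv_lhs => rw [h]
  exact f.2.1 _ _ _ _ hi fun _ _ h => h

theorem finite_size_le (N : ℕ) : {α : List ℕ+ | size α ≤ N}.Finite := by
  refine ((Finset.range (N + 1)).finite_toSet.biUnion fun n _ =>
    Set.finite_range fun c : Composition n => c.blocks.map Nat.toPNat').subset ?_
  intro α hα
  simp only [Set.mem_iUnion, Set.mem_range]
  refine ⟨size α, by simpa [Nat.lt_succ_iff] using hα, ⟨α.map PNat.val, ?_, rfl⟩, ?_⟩
  · intro b hb
    obtain ⟨a, _, rfl⟩ := List.mem_map.1 hb
    exact a.pos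
  · have h : (Nat.toPNat' ∘ PNat.val) = id := funext fun a => PNat.coe_toPNat' a
    simp [h]

theorem coord_finite {k : Type*} [Field k] (f : QSym k) : (Function.support (coord f)).Finite := by
  obtain ⟨N, hN⟩ := f.2.2
  refine (finite_size_le N).subset fun α hα => ?_
  have := hN _ hα
  rwa [degree_exps, sum_parts] at this

theorem coord_M (k : Type*) [Field k] (α β : List ℕ+) :
    coord (M k α) β = if β = α then 1 else 0 := by
  rw [coord, coeff_M, flat_exps_parts β fun _ _ h => h]

theorem qsym_ext {k : Type*} [Field k] {f g : QSym k} (h : ∀ α, coord f α = coord g α) :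
    f = g := by
  refine Subtype.ext (MvPowerSeries.ext fun d => ?_)
  rw [coeff_eq_coord, coeff_eq_coord, h]

/-- `coord` as a linear map. -/
noncomputable def coordₗ (k : Type*) [Field k] : QSym k →ₗ[k] (List ℕ+ →₀ k) where
  toFun f := Finsupp.ofSupportFinite (coord f) (coord_finite f)
  map_add' f g := Finsupp.ext fun _ => map_add (MvPowerSeries.coeff _) f.1 g.1
  map_smul' c f := Finsupp.ext fun _ => map_smul (MvPowerSeries.coeff _) c f.1

theorem coordₗ_apply {k : Type*} [Field k] (f : QSym k) (α : List ℕ+) :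
    coordₗ k f α = coord f α := rfl

theorem coordₗ_M (k : Type*) [Field k] (α : List ℕ+) :
    coordₗ k (M k α) = Finsupp.single α 1 := by
  ext β
  rw [coordₗ_apply, coord_M, Finsupp.single_apply]
  simp [eq_comm]

/-- The basis of `QSym` formed by the `M_α`. -/
noncomputable def basisM (k : Type*) [Field k] : Module.Basis (List ℕ+) k (QSym k) :=
  Module.Basis.ofRepr <| LinearEquiv.ofLinearMap (coordₗ k) (Finsupp.linearCombination k (M k))
    (by
      refine Finsupp.lhom_ext' fun α => LinearMap.ext_ring ?_
      simp [coordₗ_M])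
    (by
      have h : coordₗ k ∘ₗ Finsupp.linearCombination k (M k) = LinearMap.id := by
        refine Finsupp.lhom_ext' fun α => LinearMap.ext_ring ?_
        simp [coordₗ_M]
      refine LinearMap.ext fun f => qsym_ext fun α => ?_
      rw [← coordₗ_apply, ← coordₗ_apply]
      exact DFunLike.congr_fun (LinearMap.congr_fun h (coordₗ k f)) α)

@[simp] theorem basisM_apply (k : Type*) [Field k] (α : List ℕ+) : basisM k α = M k α := by
  simp [basisM]

/-! ### The coalgebra structure -/

open TensorProduct in
/-- `Δ(M_α) = ∑_{i=0}^k M_{(a_1,…,a_i)} ⊗ M_{(a_{i+1},…,a_k)}` and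
`ε(M_α) = 1` if `α` is empty, `0` otherwise. -/
noncomputable instance instCoalgebraStruct (k : Type*) [Field k] : CoalgebraStruct k (QSym k) where
  comul := (basisM k).constr k fun α =>
    ∑ i ∈ Finset.range (α.length + 1), M k (α.take i) ⊗ₜ[k] M k (α.drop i)
  counit := (basisM k).constr k fun α => if α = [] then 1 else 0

open TensorProduct in
theorem comul_M (k : Type*) [Field k] (α : List ℕ+) :
    CoalgebraStruct.comul (R := k) (M k α) =
      ∑ i ∈ Finset.range (α.length + 1), M k (α.take i) ⊗ₜ[k] M k (α.drop i) := by
  conv_lhs => rw [← basisM_apply]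
  exact (basisM k).constr_basis k _ α

theorem counit_M (k : Type*) [Field k] (α : List ℕ+) :
    CoalgebraStruct.counit (R := k) (M k α) = if α = [] then 1 else 0 := by
  conv_lhs => rw [← basisM_apply]
  exact (basisM k).constr_basis k _ α

noncomputable instance instCoalgebra (k : Type*) [Field k] : Coalgebra k (QSym k) where
  coassoc := by
    refine (basisM k).ext fun α => ?_
    simp only [basisM_apply, LinearMap.comp_apply, comul_M, map_sum, LinearMap.rTensor_tmul,
      LinearMap.lTensor_tmul, TensorProduct.sum_tmul, TensorProduct.tmul_sum,
      LinearEquiv.coe_coe, TensorProduct.assoc_tmul]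
    rw [Finset.sum_sigma', Finset.sum_sigma']
    refine Finset.sum_bij' (fun p _ => ⟨p.2, p.1 - p.2⟩) (fun p _ => ⟨p.1 + p.2, p.1⟩)
      ?_ ?_ ?_ ?_ ?_
    · rintro ⟨i, j⟩ h
      simp only [Finset.mem_sigma, Finset.mem_range, List.length_take, List.length_drop] at h ⊢
      omega
    · rintro ⟨i, j⟩ h
      simp only [Finset.mem_sigma, Finset.mem_range, List.length_take, List.length_drop] at h ⊢
      omega
    · rintro ⟨i, j⟩ h
      simp only [Finset.mem_sigma, Finset.mem_range, List.length_take] at h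
      have : j + (i - j) = i := by omega
      simp [this]
    · rintro ⟨i, j⟩ h
      simp
    · rintro ⟨i, j⟩ h
      simp only [Finset.mem_sigma, Finset.mem_range, List.length_take] at h
      have h1 : min j i = j := by omega
      have h2 : j + (i - j) = i := by omega
      simp [List.take_take, List.drop_take, List.drop_drop, h1, h2]
  rTensor_counit_comp_comul := by
    refine (basisM k).ext fun α => ?_
    simp only [basisM_apply, LinearMap.comp_apply, comul_M, map_sum, LinearMap.rTensor_tmul,
      counit_M, TensorProduct.mk_apply]
    rw [Finset.sum_eq_single 0]
    · simp
    · intro i hi h0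
      rw [Finset.mem_range] at hi
      have : α.take i ≠ [] := by
        intro h
        have := congrArg List.length h
        simp at this
        rcases this with h | h
        · exact h0 h
        · simp [h] at hi; exact h0 hi
      rw [if_neg this, TensorProduct.zero_tmul]
    · simp
  lTensor_counit_comp_comul := by
    refine (basisM k).ext fun α => ?_
    simp only [basisM_apply, LinearMap.comp_apply, comul_M, map_sum, LinearMap.lTensor_tmul,
      counit_M, LinearMap.flip_apply, TensorProduct.mk_apply]
    rw [Finset.sum_eq_single α.length]
    · simp
    · intro i hi h0
      rw [Finset.mem_range] at hi
      have : ¬ α.length ≤ i := by omega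
      simp [this]
    · simp

/-! ### Even and odd functionals -/

/-- The power series with the coefficient at `d` multiplied by `(-1)^(deg d)`. -/
noncomputable def conjSeries {k : Type*} [Field k] (f : MvPowerSeries ℕ k) : MvPowerSeries ℕ k :=
  fun d => (-1) ^ d.degree * MvPowerSeries.coeff d f

theorem coeff_conjSeries {k : Type*} [Field k] (f : MvPowerSeries ℕ k) (d : ℕ →₀ ℕ) :
    MvPowerSeries.coeff d (conjSeries f) = (-1) ^ d.degree * MvPowerSeries.coeff d f := rfl

/-- The automorphism `h ↦ (-1)^n h` for `h` homogeneous of degree `n`. -/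
noncomputable def conj (k : Type*) [Field k] : QSym k →ₗ[k] QSym k where
  toFun f := ⟨conjSeries f, by
    refine ⟨fun r a i j hi hj => ?_, ?_⟩
    · rw [coeff_conjSeries, coeff_conjSeries, degree_exps, degree_exps, f.2.1 r a i j hi hj]
    · obtain ⟨N, hN⟩ := f.2.2
      exact ⟨N, fun d hd => hN d (right_ne_zero_of_mul hd)⟩⟩
  map_add' f g := by
    refine Subtype.ext (MvPowerSeries.ext fun d => ?_)
    simp only [Subalgebra.coe_add, map_add, coeff_conjSeries, mul_add]
  map_smul' c f := by
    refine Subtype.ext (MvPowerSeries.ext fun d => ?_)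
    simp only [Subalgebra.coe_smul, coeff_conjSeries, MvPowerSeries.coeff_smul, RingHom.id_apply,
      mul_left_comm]

/-- The functional `φ̄ = φ ∘ (h ↦ h̄)`. -/
noncomputable def barFunctional {k : Type*} [Field k] (φ : QSym k →ₗ[k] k) : QSym k →ₗ[k] k :=
  φ ∘ₗ conj k

/-- `φ` is even: `φ̄ = φ`. -/
def IsEvenFunctional {k : Type*} [Field k] (φ : QSym k →ₗ[k] k) : Prop := barFunctional φ = φ

/-- `φ` is odd: it is invertible for the convolution product, with inverse `φ̄`. -/
def IsOddFunctional {k : Type*} [Field k] (φ : QSym k →ₗ[k] k) : Prop :=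
  WithConv.toConv φ * WithConv.toConv (barFunctional φ) = 1 ∧
    WithConv.toConv (barFunctional φ) * WithConv.toConv φ = 1

/-- `ρ` and `ψ` are an even part and an odd part of the functional `φ`: `φ = ρψ` (convolution
product) with `ρ` even, `ψ` odd and `ρ(1) = ψ(1) = 1`. -/
structure IsEvenOddDecomposition {k : Type*} [Field k] (φ ρ ψ : QSym k →ₗ[k] k) : Prop where
  even_map_one : ρ 1 = 1
  odd_map_one : ψ 1 = 1
  even : IsEvenFunctional ρ
  odd : IsOddFunctional ψ
  eq_mul : WithConv.toConv φ = WithConv.toConv ρ * WithConv.toConv ψ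

/-- The universal character: `ζ(M_α) = 1` if `α = (n)` or `α = ()`, and `0` otherwise. -/
noncomputable def zeta (k : Type*) [Field k] : QSym k →ₗ[k] k :=
  (basisM k).constr k fun α => if α.length ≤ 1 then 1 else 0

/-! ### Numbers -/

open Nat in
/-- The bivariate Catalan number `(2m)! (2n)! / (m! (m+n)! n!)`; the division is exact. -/
def bivariateCatalan (m n : ℕ) : ℕ := (2 * m)! * (2 * n)! / (m ! * (m + n)! * n !)

open Nat in
theorem dvd_bivariateCatalan (m n : ℕ) :
    m ! * (m + n)! * n ! ∣ (2 * m)! * (2 * n)! := by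
  induction n generalizing m with
  | zero =>
    have := Nat.factorial_mul_factorial_dvd_factorial_add m m
    simpa [two_mul] using this
  | succ n ih =>
    obtain ⟨x, hx⟩ := ih m
    obtain ⟨y, hy⟩ := ih (m + 1)
    have h1 : (2 * (m + 1))! = (2 * m + 2) * ((2 * m + 1) * (2 * m)!) := by
      rw [show 2 * (m + 1) = 2 * m + 1 + 1 by ring, Nat.factorial_succ, Nat.factorial_succ]
    have h2 : (2 * (n + 1))! = (2 * n + 2) * ((2 * n + 1) * (2 * n)!) := by
      rw [show 2 * (n + 1) = 2 * n + 1 + 1 by ring, Nat.factorial_succ, Nat.factorial_succ]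
    have h3 : (m + 1 + n)! = (m + n + 1) * (m + n)! := by
      rw [show m + 1 + n = m + n + 1 by ring, Nat.factorial_succ]
    rw [h1, h3, Nat.factorial_succ m] at hy
    rw [h2, show m + (n + 1) = m + n + 1 by ring, Nat.factorial_succ (m + n), Nat.factorial_succ n]
    zify at hx hy ⊢
    refine ⟨4 * x - y, ?_⟩
    have hm : ((m : ℤ) + 1) ≠ 0 := by positivity
    apply mul_left_cancel₀ hm
    linear_combination (-(n + 1 : ℤ)) * hy * (-1) * (-1) + 4 * (m + 1) * (n + 1) * (m + n + 1) * hx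

/-- The number of even parts of `α`. -/
def numEven (α : List ℕ+) : ℕ := α.countP fun a => Even (a : ℕ)

/-- The number of odd parts of `α`. -/
def numOdd (α : List ℕ+) : ℕ := α.countP fun a => Odd (a : ℕ)

end QSymm

namespace QSymm

/-! ### A convolution identity for central binomial coefficients -/

/-! The odd part is written down explicitly and verified. Let c_n be the coefficients of f(x) =
√((1+x)/(1-x)) = (1+x)/√(1-x²), and let ψ(M_α) = (-1)^{k_e} c_{k_o} if α is empty or ends in an odd
part, and 0 otherwise. When ψψ̄ is evaluated at α ending in an odd part, the prefixes that
contribute contain 0, 1, …, k_o odd parts, each count occurring once. The sum is therefore a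
coefficient of f(x)f(-x) = 1 (`sum_sqrtCoeff_alternating`, `sum_oddValue_mul`).

The even part is then forced to be ρ = ζψ̄. As ζ vanishes on M_β when β has two or more parts, only
the splittings after 0 and after 1 part survive, and ρ(M_α) is a signed difference of two values of
ψ. It cancels unless both end parts and k_o obey the stated parity conditions, when c_{2m+2} -
c_{2m} produces C(1,m). In particular ρ vanishes in odd degrees, so it is even.

Multiplicativity is not checked on the formulas. Any decomposition φ = ρψ gives φ̄ψ² = φ
(`IsEvenOddDecomposition.bar_mul_sq`). Since ζ and ζ̄ are multiplicative and Δ is compatible with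
products (`comul_M_mul_M`), convolution cancellation makes ψ² multiplicative, and extraction of the
square root, which needs 2 ≠ 0, makes ψ multiplicative; then so is ρ = ζψ̄. Both steps compare
functions of two compositions, (α, β) ↦ φ(M_α M_β) and (α, β) ↦ φ(M_α)φ(M_β), by induction on total
length (`pairConv_left_cancel`, `pairConv_sqrt_unique`). The same two lemmas give uniqueness. -/

open Finset in
theorem sum_centralBinom_mul_centralBinom (n : ℕ) :
    ∑ p ∈ antidiagonal n, p.1.centralBinom * p.2.centralBinom = 4 ^ n := by
  set S : ℕ → ℕ := fun n => ∑ p ∈ antidiagonal n, p.1.centralBinom * p.2.centralBinom with hS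
  set T : ℕ → ℕ := fun n => ∑ p ∈ antidiagonal n, p.1 * (p.1.centralBinom * p.2.centralBinom)
    with hT
  -- The summand of S is symmetric, so weighting by the first index or by the second gives the same
  -- sum, and the two weights add up to n.
  have h1 (n : ℕ) : 2 * T n = n * S n := by
    have hswap : T n = ∑ p ∈ antidiagonal n, p.2 * (p.1.centralBinom * p.2.centralBinom) := by
      rw [hT, ← Finset.Nat.sum_antidiagonal_swap]
      exact sum_congr rfl fun p _ => by simp [mul_comm p.1.centralBinom]
    rw [two_mul]
    nth_rw 2 [hswap]
    rw [hT, ← sum_add_distrib, hS, mul_sum]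
    refine sum_congr rfl fun p hp => ?_
    rw [← mem_antidiagonal.1 hp, add_mul]
  -- From (p+1)·binom(2p+2, p+1) = 2(2p+1)·binom(2p, p). With the symmetry relation this yields
  -- (n+1)S(n+1) = 4(n+1)S(n).
  have h2 (n : ℕ) : T (n + 1) = 4 * T n + 2 * S n := by
    simp only [hT, hS]
    rw [Finset.Nat.sum_antidiagonal_succ, mul_sum, mul_sum, ← sum_add_distrib]
    simp only [zero_mul, zero_add]
    refine sum_congr rfl fun p _ => ?_
    rw [← mul_assoc, Nat.succ_mul_centralBinom_succ]
    ring
  change S n = 4 ^ n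
  induction n with
  | zero => simp [hS]
  | succ n ih =>
    have := h1 (n + 1)
    rw [h2, mul_add, mul_left_comm, h1] at this
    rw [pow_succ, ← ih]
    refine Nat.eq_of_mul_eq_mul_left (Nat.succ_pos n) ?_
    rw [Nat.succ_eq_add_one, ← this]
    ring

/-- The coefficients of the expansion of `√((1 + x) / (1 - x))`. -/
def sqrtCoeff (k : Type*) [Field k] (n : ℕ) : k := (n / 2).centralBinom / 4 ^ (n / 2)

@[simp] theorem sqrtCoeff_zero (k : Type*) [Field k] : sqrtCoeff k 0 = 1 := by simp [sqrtCoeff]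

theorem four_ne_zero' {k : Type*} [Field k] (h2 : (2 : k) ≠ 0) : (4 : k) ≠ 0 := by
  rw [show (4 : k) = 2 * 2 by norm_num]
  exact mul_ne_zero h2 h2

open Finset in
-- The even-indexed coefficients are those of (1-x²)^{-1/2}, whose square is the geometric series in
-- x².
theorem sum_sqrtCoeff_even {k : Type*} [Field k] (h2 : (2 : k) ≠ 0) (m : ℕ) :
    ∑ i ∈ range (m + 1), sqrtCoeff k (2 * i) * sqrtCoeff k (2 * (m - i)) = 1 := by
  have h4 : (4 : k) ^ m ≠ 0 := pow_ne_zero _ (four_ne_zero' h2)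
  have h := congrArg (Nat.cast : ℕ → k) (sum_centralBinom_mul_centralBinom m)
  rw [Finset.Nat.sum_antidiagonal_eq_sum_range_succ_mk] at h
  push_cast at h
  rw [← div_self h4]
  nth_rw 1 [← h]
  rw [sum_div]
  refine sum_congr rfl fun i hi => ?_
  have hi : i ≤ m := by simpa [Nat.lt_succ_iff] using hi
  simp only [sqrtCoeff, Nat.mul_div_cancel_left _ two_pos]
  rw [div_mul_div_comm, ← pow_add, Nat.add_sub_cancel' hi]

theorem sqrtCoeff_odd (k : Type*) [Field k] (m : ℕ) :
    sqrtCoeff k (2 * m + 1) = sqrtCoeff k (2 * m) := by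
  rw [sqrtCoeff, sqrtCoeff, show (2 * m + 1) / 2 = 2 * m / 2 by omega]

open Finset in
theorem sum_range_two_mul_succ {A : Type*} [AddCommMonoid A] (f : ℕ → A) (m : ℕ) :
    ∑ j ∈ range (2 * m + 1), f j =
      ∑ i ∈ range (m + 1), f (2 * i) + ∑ i ∈ range m, f (2 * i + 1) := by
  induction m with
  | zero => simp
  | succ m ih =>
    rw [show 2 * (m + 1) + 1 = 2 * m + 1 + 1 + 1 by ring, sum_range_succ, sum_range_succ, ih,
      sum_range_succ _ (m + 1), sum_range_succ (fun i => f (2 * i + 1)) m,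
      show 2 * m + 1 + 1 = 2 * (m + 1) by ring]
    abel

open Finset in
-- This is f(x)f(-x) = 1 coefficientwise. For even n > 0 the even and the odd indices contribute 1
-- and -1; for odd n the reflection j ↦ n - j changes the sign of the sum.
theorem sum_sqrtCoeff_alternating {k : Type*} [Field k] (h2 : (2 : k) ≠ 0) (n : ℕ) :
    ∑ j ∈ range (n + 1), sqrtCoeff k j * ((-1) ^ (n - j) * sqrtCoeff k (n - j)) =
      if n = 0 then 1 else 0 := by
  rcases Nat.even_or_odd' n with ⟨m, rfl | rfl⟩
  · cases m with
    | zero => simp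
    | succ m =>
      rw [if_neg (by omega), sum_range_two_mul_succ]
      have he : ∑ i ∈ range (m + 1 + 1), sqrtCoeff k (2 * i) *
          ((-1) ^ (2 * (m + 1) - 2 * i) * sqrtCoeff k (2 * (m + 1) - 2 * i)) = 1 := by
        refine Eq.trans ?_ (sum_sqrtCoeff_even h2 (m + 1))
        refine sum_congr rfl fun i _ => ?_
        rw [← Nat.mul_sub, (even_two_mul _).neg_one_pow, one_mul]
      have ho : ∑ i ∈ range (m + 1), sqrtCoeff k (2 * i + 1) *
          ((-1) ^ (2 * (m + 1) - (2 * i + 1)) * sqrtCoeff k (2 * (m + 1) - (2 * i + 1))) = -1 := by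
        refine Eq.trans ?_ (congrArg Neg.neg (sum_sqrtCoeff_even h2 m))
        rw [← sum_neg_distrib]
        refine sum_congr rfl fun i hi => ?_
        have hi : i ≤ m := by simpa [Nat.lt_succ_iff] using hi
        rw [show 2 * (m + 1) - (2 * i + 1) = 2 * (m - i) + 1 by omega, sqrtCoeff_odd,
          sqrtCoeff_odd, (odd_two_mul_add_one _).neg_one_pow]
        ring
      rw [he, ho, add_neg_cancel]
  · rw [if_neg (by omega)]
    set s := ∑ j ∈ range (2 * m + 1 + 1),
      sqrtCoeff k j * ((-1) ^ (2 * m + 1 - j) * sqrtCoeff k (2 * m + 1 - j)) with hs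
    have h : s = -s := by
      conv_lhs => rw [hs, ← sum_range_reflect]
      rw [hs, ← sum_neg_distrib]
      refine sum_congr rfl fun j hj => ?_
      have hj : j ≤ 2 * m + 1 := by simpa [Nat.lt_succ_iff] using hj
      rw [show 2 * m + 1 + 1 - 1 - j = 2 * m + 1 - j by omega, Nat.sub_sub_self hj]
      have hpar : (-1 : k) ^ j = -(-1) ^ (2 * m + 1 - j) := by
        have : (-1 : k) ^ (2 * m + 1 - j) * (-1) ^ j = -1 := by
          rw [← pow_add, Nat.sub_add_cancel hj, (odd_two_mul_add_one _).neg_one_pow]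
        rcases neg_one_pow_eq_or k (2 * m + 1 - j) with h | h <;> rw [h] at this ⊢
        · simpa using this
        · linear_combination -this
      rw [hpar]
      ring
    have h' : 2 * s = 0 := by linear_combination h
    exact (mul_eq_zero.1 h').resolve_left h2

/-- Both sides equal 2·binom(2m, m)/(m+1). This is the source of C(1, m) in the even part. -/
theorem centralBinom_sub_eq (m : ℕ) :
    (4 * (m.centralBinom : ℤ)) - (m + 1).centralBinom = bivariateCatalan 1 m := by
  have h := Nat.succ_mul_centralBinom_succ m
  have hc : bivariateCatalan 1 m * (1 * (1 + m).factorial * m.factorial) =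
      2 * (2 * m).factorial := Nat.div_mul_cancel (dvd_bivariateCatalan 1 m)
  have hm := Nat.choose_mul_factorial_mul_factorial (show m ≤ 2 * m by omega)
  rw [show 2 * m - m = m by omega, ← Nat.centralBinom_eq_two_mul_choose] at hm
  have hpos : (0 : ℤ) < m.factorial := by exact_mod_cast Nat.factorial_pos m
  rw [add_comm 1 m, Nat.factorial_succ, ← hm] at hc
  zify at h hc
  have hm1 : (m + 1 : ℤ) ≠ 0 := by positivity
  have hc' : (bivariateCatalan 1 m : ℤ) * (m + 1) = 2 * m.centralBinom := by
    have h0 : (m.factorial * m.factorial : ℤ) ≠ 0 := by positivity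
    apply mul_left_cancel₀ h0
    linear_combination hc
  apply mul_left_cancel₀ hm1
  linear_combination -h - hc'

theorem bivariateCatalan_zero_left (m : ℕ) : bivariateCatalan 0 m = m.centralBinom := by
  simp [bivariateCatalan, Nat.centralBinom_eq_two_mul_choose,
    Nat.choose_eq_factorial_div_factorial (show m ≤ 2 * m by omega), show 2 * m - m = m by omega]

/-! ### The values of the odd part -/

theorem size_append (α β : List ℕ+) : size (α ++ β) = size α + size β := by simp [size]

theorem numOdd_append (α β : List ℕ+) : numOdd (α ++ β) = numOdd α + numOdd β := by
  simp [numOdd]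

theorem numEven_append (α β : List ℕ+) : numEven (α ++ β) = numEven α + numEven β := by
  simp [numEven]

theorem neg_one_pow_size {k : Type*} [Field k] (α : List ℕ+) :
    (-1 : k) ^ size α = (-1) ^ numOdd α := by
  induction α with
  | nil => simp [size, numOdd]
  | cons a α ih =>
    rw [← List.singleton_append, size_append, numOdd_append, pow_add, pow_add, ih]
    rcases Nat.even_or_odd (a : ℕ) with h | h
    · simp [size, numOdd, h.neg_one_pow, Nat.not_odd_iff_even.2 h]
    · simp [size, numOdd, h.neg_one_pow, h]

/-- `α` is empty or its last part is odd. -/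
def EndsOdd (α : List ℕ+) : Prop := ∀ h : α ≠ [], Odd (α.getLast h : ℕ)

theorem endsOdd_nil : EndsOdd [] := fun h => (h rfl).elim

theorem endsOdd_append {α β : List ℕ+} (hβ : β ≠ []) : EndsOdd (α ++ β) ↔ EndsOdd β := by
  simp [EndsOdd, List.getLast_append_of_ne_nil, hβ]

theorem endsOdd_drop {α : List ℕ+} {i : ℕ} (hi : i < α.length) :
    EndsOdd (α.drop i) ↔ EndsOdd α := by
  conv_rhs => rw [← List.take_append_drop i α]
  refine (endsOdd_append fun h => ?_).symm
  rw [List.drop_eq_nil_iff] at h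
  omega

open Classical Finset in
-- A prefix that is empty or stops at an odd part is determined by its number of odd parts, and
-- every number from 0 to `numOdd α` occurs.
theorem sum_endsOdd_take {A : Type*} [AddCommMonoid A] (h : ℕ → A) (α : List ℕ+) :
    ∑ i ∈ range (α.length + 1), (if EndsOdd (α.take i) then h (numOdd (α.take i)) else 0) =
      ∑ j ∈ range (numOdd α + 1), h j := by
  induction α using List.reverseRecOn with
  | nil => simp [endsOdd_nil, numOdd]
  | append_singleton α a ih =>
    rw [List.length_append, List.length_singleton, sum_range_succ,
      List.take_of_length_le (by simp), endsOdd_append (by simp), numOdd_append]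
    have : ∑ i ∈ range (α.length + 1), (if EndsOdd ((α ++ [a]).take i) then
        h (numOdd ((α ++ [a]).take i)) else 0) = ∑ j ∈ range (numOdd α + 1), h j := by
      rw [← ih]
      refine sum_congr rfl fun i hi => ?_
      rw [List.take_append_of_le_length (by simpa [Nat.lt_succ_iff] using hi)]
    rw [this]
    by_cases ha : Odd (a : ℕ)
    · simp [EndsOdd, numOdd, ha, sum_range_succ]
    · simp [EndsOdd, numOdd, ha]

open Classical in
/-- The value of the odd part of the universal character at `M_α`. -/
noncomputable def oddValue (k : Type*) [Field k] (α : List ℕ+) : k :=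
  if EndsOdd α then (-1) ^ numEven α * sqrtCoeff k (numOdd α) else 0

@[simp] theorem oddValue_nil (k : Type*) [Field k] : oddValue k [] = 1 := by
  simp [oddValue, endsOdd_nil, numEven, numOdd]

open Classical Finset in
-- This is ψψ̄ = ε on the basis. If α ends in an odd part, every suffix qualifies and the sign
-- (-1)^{k_e} factors out. Otherwise each nonempty suffix kills its term, and the full prefix kills
-- the last one.
theorem sum_oddValue_mul {k : Type*} [Field k] (h2 : (2 : k) ≠ 0) (α : List ℕ+) :
    ∑ i ∈ range (α.length + 1),
      oddValue k (α.take i) * ((-1) ^ size (α.drop i) * oddValue k (α.drop i)) =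
        if α = [] then 1 else 0 := by
  by_cases hα : EndsOdd α
  · have hterm : ∀ i ∈ range (α.length + 1),
        oddValue k (α.take i) * ((-1) ^ size (α.drop i) * oddValue k (α.drop i)) =
        if EndsOdd (α.take i) then (-1) ^ numEven α * (sqrtCoeff k (numOdd (α.take i)) *
          ((-1) ^ (numOdd α - numOdd (α.take i)) *
            sqrtCoeff k (numOdd α - numOdd (α.take i)))) else 0 := by
      intro i hi
      have hd : EndsOdd (α.drop i) := by
        rcases lt_or_ge i α.length with h | h
        · exact (endsOdd_drop h).2 hα
        · rw [List.drop_of_length_le h]; exact endsOdd_nil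
      have ho : numOdd α - numOdd (α.take i) = numOdd (α.drop i) := by
        conv_lhs => rw [← List.take_append_drop i α, numOdd_append]
        simp
      have he : numEven α = numEven (α.take i) + numEven (α.drop i) := by
        rw [← numEven_append, List.take_append_drop]
      rw [oddValue, oddValue, if_pos hd, ho, he, neg_one_pow_size, pow_add]
      split_ifs
      · ring
      · ring
    rw [sum_congr rfl hterm, sum_endsOdd_take (fun j => (-1) ^ numEven α * (sqrtCoeff k j *
      ((-1) ^ (numOdd α - j) * sqrtCoeff k (numOdd α - j)))), ← mul_sum,
      sum_sqrtCoeff_alternating h2]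
    by_cases h : α = []
    · simp [h, numEven, numOdd]
    -- The last part of a nonempty α is odd here, so the alternating sum has positive index and
    -- vanishes.
    · have : numOdd α ≠ 0 := by
        rw [numOdd, ← Nat.pos_iff_ne_zero, List.countP_pos_iff]
        exact ⟨_, by simpa using ⟨_, List.getLast_mem h, rfl⟩, by simpa using hα h⟩
      simp [h, this]
  · have hne : α ≠ [] := fun h => hα (h ▸ endsOdd_nil)
    rw [if_neg hne]
    refine sum_eq_zero fun i hi => ?_
    rcases lt_or_ge i α.length with h | h
    · rw [oddValue, oddValue, if_neg (mt (endsOdd_drop h).1 hα)]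
      simp
    · rw [List.take_of_length_le h, oddValue, if_neg hα, zero_mul]

open Finset in
-- Multiplying the previous identity by the global sign (-1)^{|α|} moves the conjugation from the
-- right factor to the left one.
theorem sum_mul_oddValue {k : Type*} [Field k] (h2 : (2 : k) ≠ 0) (α : List ℕ+) :
    ∑ i ∈ range (α.length + 1),
      ((-1) ^ size (α.take i) * oddValue k (α.take i)) * oddValue k (α.drop i) =
        if α = [] then 1 else 0 := by
  have h := congrArg ((-1) ^ size α * ·) (sum_oddValue_mul h2 α)
  simp only [mul_sum] at h
  trans ((-1) ^ size α * if α = [] then (1 : k) else 0)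
  · rw [← h]
    refine sum_congr rfl fun i _ => ?_
    nth_rw 4 [← List.take_append_drop i α]
    rw [size_append, pow_add]
    have : (-1 : k) ^ size (α.drop i) * (-1) ^ size (α.drop i) = 1 := by
      rw [← mul_pow]; simp
    linear_combination (-1) * ((-1) ^ size (α.take i) * oddValue k (α.take i)) *
      oddValue k (α.drop i) * this
  · split_ifs with h
    · simp [h, size]
    · simp

/-! ### Compatibility of the coproduct with the product -/

theorem flat_add {u v : ℕ →₀ ℕ} (h : ∀ m ∈ u.support, ∀ n ∈ v.support, m < n) :
    flat (u + v) = flat u ++ flat v := by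
  have hdisj : Disjoint u.support v.support :=
    Finset.disjoint_left.2 fun m hm hm' => (h m hm m hm').false
  have hsort : (u + v).support.sort = u.support.sort ++ v.support.sort := by
    have hp : (u.support.sort ++ v.support.sort).Pairwise (· < ·) := by
      rw [List.pairwise_append]
      refine ⟨Finset.sortedLT_sort _ |>.pairwise, Finset.sortedLT_sort _ |>.pairwise, ?_⟩
      intro a ha b hb
      exact h a ((Finset.mem_sort _).1 ha) b ((Finset.mem_sort _).1 hb)
    have hs : (u.support.sort ++ v.support.sort).toFinset = (u + v).support := by
      rw [Finsupp.support_add_eq hdisj]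
      simp [List.toFinset_append]
    rw [← hs]
    exact (List.toFinset_sort (· ≤ ·) (hp.imp fun h => h.ne)).2 (hp.imp fun h => h.le)
  rw [flat, hsort, List.map_append, flat, flat]
  congr 1
  · refine List.map_congr_left fun n hn => ?_
    have : n ∉ v.support := Finset.disjoint_left.1 hdisj ((Finset.mem_sort _).1 hn)
    simp [Finsupp.notMem_support_iff.1 this]
  · refine List.map_congr_left fun n hn => ?_
    have : n ∉ u.support := Finset.disjoint_right.1 hdisj ((Finset.mem_sort _).1 hn)
    simp [Finsupp.notMem_support_iff.1 this]

theorem support_subset_of_mem_antidiagonal {d : ℕ →₀ ℕ} {p : (ℕ →₀ ℕ) × (ℕ →₀ ℕ)}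
    (hp : p ∈ Finset.HasAntidiagonal.antidiagonal d) :
    p.1.support ⊆ d.support ∧ p.2.support ⊆ d.support := by
  rw [Finset.HasAntidiagonal.mem_antidiagonal] at hp
  rw [← hp]
  constructor <;> intro n hn <;> simp only [Finsupp.mem_support_iff, Finsupp.add_apply] at hn ⊢ <;>
    omega

/-- Factoring a product of two monomials in disjoint sets of variables amounts to factoring each
separately; restriction to the two supports recovers the pieces. -/
theorem sum_antidiagonal_add_of_disjoint {A : Type*} [AddCommMonoid A] {d e : ℕ →₀ ℕ}
    (hd : Disjoint d.support e.support) (F : (ℕ →₀ ℕ) × (ℕ →₀ ℕ) → A) :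
    ∑ p ∈ Finset.HasAntidiagonal.antidiagonal (d + e), F p =
      ∑ p ∈ Finset.HasAntidiagonal.antidiagonal d, ∑ q ∈ Finset.HasAntidiagonal.antidiagonal e,
        F (p + q) := by
  classical
  rw [← Finset.sum_product']
  symm
  have hmem (u : ℕ →₀ ℕ) (n : ℕ) : u n = 0 ∨ n ∈ u.support := by
    rw [Finsupp.mem_support_iff]; exact eq_or_ne _ _
  have hdn (n : ℕ) : d n = 0 ∨ e n = 0 := by
    rcases hmem d n with h | h
    · exact Or.inl h
    · exact Or.inr (Finsupp.notMem_support_iff.1 (Finset.disjoint_left.1 hd h))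
  refine Finset.sum_bij' (fun x _ => x.1 + x.2)
    (fun p _ => ((p.1.filter (· ∈ d.support), p.2.filter (· ∈ d.support)),
      (p.1.filter (· ∈ e.support), p.2.filter (· ∈ e.support)))) ?_ ?_ ?_ ?_ ?_
  · rintro ⟨p, q⟩ h
    simp only [Finset.mem_product, Finset.HasAntidiagonal.mem_antidiagonal] at h ⊢
    rw [← h.1, ← h.2, Prod.fst_add, Prod.snd_add]
    abel
  · rintro p h
    simp only [Finset.mem_product, Finset.HasAntidiagonal.mem_antidiagonal] at h ⊢
    constructor
    · rw [← Finsupp.filter_add, h]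
      ext n
      rw [Finsupp.filter_apply]
      simp only [Finsupp.mem_support_iff, Finsupp.add_apply]
      have := hdn n
      split_ifs <;> omega
    · rw [← Finsupp.filter_add, h]
      ext n
      rw [Finsupp.filter_apply]
      simp only [Finsupp.mem_support_iff, Finsupp.add_apply]
      have := hdn n
      split_ifs <;> omega
  · rintro ⟨⟨p, p'⟩, q, q'⟩ h
    simp only [Finset.mem_product, Finset.HasAntidiagonal.mem_antidiagonal] at h
    have h1 (n : ℕ) : p n + p' n = d n := by rw [← h.1]; rfl
    have h2 (n : ℕ) : q n + q' n = e n := by rw [← h.2]; rfl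
    simp only [Prod.mk.injEq]
    refine ⟨⟨?_, ?_⟩, ?_, ?_⟩ <;> ext n <;> rw [Finsupp.filter_apply] <;>
      simp only [Finsupp.mem_support_iff, Finsupp.add_apply, Prod.fst_add, Prod.snd_add] <;>
      have := h1 n <;> have := h2 n <;> have := hdn n <;> split_ifs <;> omega
  · rintro ⟨u, v⟩ h
    simp only [Finset.HasAntidiagonal.mem_antidiagonal] at h
    have h1 (n : ℕ) : u n + v n = d n + e n := by rw [← Finsupp.add_apply, h]; rfl
    refine Prod.ext ?_ ?_ <;> ext n <;>
      simp only [Prod.fst_add, Prod.snd_add, Finsupp.add_apply, Finsupp.filter_apply,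
        Finsupp.mem_support_iff] <;>
      have := h1 n <;> have := hdn n <;> split_ifs <;> omega
  · intro x _
    rfl

open Finset in
theorem append_eq_iff_sum (k : Type*) [Field k] (α δ ε : List ℕ+) :
    (if δ ++ ε = α then (1 : k) else 0) = ∑ i ∈ range (α.length + 1),
      (if δ = α.take i then 1 else 0) * (if ε = α.drop i then 1 else 0) := by
  split_ifs with h
  · subst h
    rw [sum_eq_single δ.length]
    · simp
    · intro i hi hne
      rw [if_neg, zero_mul]
      intro h
      have := congrArg List.length h
      rw [List.length_take] at this
      rw [mem_range] at hi
      omega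
    · simp
  · symm
    refine sum_eq_zero fun i _ => ?_
    by_cases h1 : δ = α.take i
    · rw [if_neg (c := ε = _), mul_zero]
      rintro rfl
      exact h (by rw [h1, List.take_append_drop])
    · rw [if_neg h1, zero_mul]

open Finset in
-- The coefficient at δ ++ ε is read off with the variables of δ all before those of ε. Every
-- factorization of the monomial then splits along these two blocks, and on each factor M_γ
-- deconcatenates.
theorem coord_M_mul_M_append {k : Type*} [Field k] (α β δ ε : List ℕ+) :
    coord (M k α * M k β) (δ ++ ε) =
      ∑ i ∈ range (α.length + 1), ∑ j ∈ range (β.length + 1),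
        coord (M k (α.take i) * M k (β.take j)) δ *
          coord (M k (α.drop i) * M k (β.drop j)) ε := by
  set d : ℕ →₀ ℕ := exps (fun s : Fin δ.length => (s : ℕ)) (parts δ) with hd
  set e : ℕ →₀ ℕ := exps (fun s : Fin ε.length => (s : ℕ) + δ.length) (parts ε) with he
  have hfd : flat d = δ := flat_exps_parts δ fun _ _ h => h
  have hfe : flat e = ε := flat_exps_parts ε fun _ _ h => by simpa using h
  have hlt : ∀ m ∈ d.support, ∀ n ∈ e.support, m < n := by
    intro m hm n hn
    have h1 : m < δ.length := by
      by_contra h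
      exact Finsupp.mem_support_iff.1 hm (exps_apply_of_notMem _ fun s => by have := s.2; omega)
    have h2 : δ.length ≤ n := by
      by_contra h
      exact Finsupp.mem_support_iff.1 hn (exps_apply_of_notMem _ fun s => by omega)
    omega
  have hdisj : Disjoint d.support e.support :=
    Finset.disjoint_left.2 fun m hm hm' => (hlt m hm m hm').false
  have hde : flat (d + e) = δ ++ ε := by rw [flat_add hlt, hfd, hfe]
  have hsplit (γ : List ℕ+) {u v : ℕ →₀ ℕ} (hu : u.support ⊆ d.support)
      (hv : v.support ⊆ e.support) :
      MvPowerSeries.coeff (u + v) (M k γ : MvPowerSeries ℕ k) = ∑ i ∈ range (γ.length + 1),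
        MvPowerSeries.coeff u (M k (γ.take i) : MvPowerSeries ℕ k) *
          MvPowerSeries.coeff v (M k (γ.drop i) : MvPowerSeries ℕ k) := by
    simp only [coeff_M]
    rw [flat_add fun m hm n hn => hlt m (hu hm) n (hv hn), append_eq_iff_sum]
  conv_lhs => rw [← hde, ← coeff_eq_coord, MulMemClass.coe_mul, MvPowerSeries.coeff_mul,
    sum_antidiagonal_add_of_disjoint hdisj]
  conv_rhs =>
    enter [2, i, 2, j]
    rw [← hfd, ← hfe, ← coeff_eq_coord, ← coeff_eq_coord, MulMemClass.coe_mul, MulMemClass.coe_mul,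
      MvPowerSeries.coeff_mul, MvPowerSeries.coeff_mul, sum_mul_sum]
  have hL : ∀ p ∈ antidiagonal d, ∀ q ∈ antidiagonal e,
      MvPowerSeries.coeff (p + q).1 (M k α : MvPowerSeries ℕ k) *
        MvPowerSeries.coeff (p + q).2 (M k β : MvPowerSeries ℕ k) =
      ∑ i ∈ range (α.length + 1), ∑ j ∈ range (β.length + 1),
        MvPowerSeries.coeff p.1 (M k (α.take i) : MvPowerSeries ℕ k) *
          MvPowerSeries.coeff p.2 (M k (β.take j) : MvPowerSeries ℕ k) *
        (MvPowerSeries.coeff q.1 (M k (α.drop i) : MvPowerSeries ℕ k) *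
          MvPowerSeries.coeff q.2 (M k (β.drop j) : MvPowerSeries ℕ k)) := by
    intro p hp q hq
    have hp := support_subset_of_mem_antidiagonal hp
    have hq := support_subset_of_mem_antidiagonal hq
    rw [Prod.fst_add, Prod.snd_add, hsplit α hp.1 hq.1, hsplit β hp.2 hq.2, sum_mul_sum]
    exact sum_congr rfl fun i _ => sum_congr rfl fun j _ => mul_mul_mul_comm _ _ _ _
  rw [sum_congr rfl fun p hp => sum_congr rfl fun q hq => hL p hp q hq]
  rw [sum_congr rfl fun p _ => sum_comm, sum_comm]
  refine sum_congr rfl fun i _ => ?_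
  rw [sum_congr rfl fun p _ => sum_comm, sum_comm]

open TensorProduct in
-- Deconcatenation is dual to concatenation; this form applies to all f, in particular to products
-- M_α M_β.
theorem tensor_repr_comul {k : Type*} [Field k] (f : QSym k) (δ ε : List ℕ+) :
    ((basisM k).tensorProduct (basisM k)).repr (CoalgebraStruct.comul (R := k) f) (δ, ε) =
      coord f (δ ++ ε) := by
  let L : QSym k →ₗ[k] k := Finsupp.lapply (δ, ε) ∘ₗ
    ((basisM k).tensorProduct (basisM k)).repr.toLinearMap ∘ₗ CoalgebraStruct.comul (R := k)
  let R : QSym k →ₗ[k] k := Finsupp.lapply (δ ++ ε) ∘ₗ coordₗ k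
  suffices h : L = R from LinearMap.congr_fun h f
  refine (basisM k).ext fun α => ?_
  have hrepr (α β : List ℕ+) : (basisM k).repr (M k α) β = if β = α then 1 else 0 := coord_M k α β
  simp only [L, R, LinearMap.comp_apply, basisM_apply, comul_M, map_sum, Finsupp.lapply_apply,
    LinearEquiv.coe_coe, Module.Basis.tensorProduct_repr_tmul_apply, coordₗ_apply, coord_M, hrepr,
    append_eq_iff_sum, smul_eq_mul]
  exact Finset.sum_congr rfl fun _ _ => mul_comm _ _

open TensorProduct Finset in
theorem comul_M_mul_M {k : Type*} [Field k] (α β : List ℕ+) :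
    CoalgebraStruct.comul (R := k) (M k α * M k β) =
      ∑ i ∈ range (α.length + 1), ∑ j ∈ range (β.length + 1),
        (M k (α.take i) * M k (β.take j)) ⊗ₜ[k] (M k (α.drop i) * M k (β.drop j)) := by
  refine ((basisM k).tensorProduct (basisM k)).repr.injective (Finsupp.ext ?_)
  rintro ⟨δ, ε⟩
  have hrepr (f : QSym k) (β : List ℕ+) : (basisM k).repr f β = coord f β := rfl
  rw [tensor_repr_comul, coord_M_mul_M_append]
  simp only [map_sum, Finsupp.finsetSum_apply, Module.Basis.tensorProduct_repr_tmul_apply, hrepr,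
    smul_eq_mul]
  exact sum_congr rfl fun _ _ => sum_congr rfl fun _ _ => mul_comm _ _

/-! ### Convolution of functionals -/

open Finset in
theorem convMul_M {k : Type*} [Field k] (φ φ' : WithConv (QSym k →ₗ[k] k)) (α : List ℕ+) :
    (φ * φ') (M k α) = ∑ i ∈ range (α.length + 1), φ (M k (α.take i)) * φ' (M k (α.drop i)) := by
  rw [LinearMap.convMul_apply, comul_M]
  simp only [map_sum, TensorProduct.map_tmul, LinearMap.mul'_apply]

open Finset in
theorem convMul_M_mul_M {k : Type*} [Field k] (φ φ' : WithConv (QSym k →ₗ[k] k))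
    (α β : List ℕ+) :
    (φ * φ') (M k α * M k β) = ∑ i ∈ range (α.length + 1), ∑ j ∈ range (β.length + 1),
      φ (M k (α.take i) * M k (β.take j)) * φ' (M k (α.drop i) * M k (β.drop j)) := by
  rw [LinearMap.convMul_apply, comul_M_mul_M]
  simp only [map_sum, TensorProduct.map_tmul, LinearMap.mul'_apply]

theorem M_nil (k : Type*) [Field k] : M k [] = 1 := by
  classical
  refine qsym_ext fun α => ?_
  rw [coord_M, coord]
  rw [OneMemClass.coe_one, MvPowerSeries.coeff_one]
  congr 1
  refine propext ⟨?_, ?_⟩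
  · rintro rfl
    simp [exps]
  · intro h
    have := congrArg Finsupp.degree h
    rw [degree_exps, sum_parts, map_zero] at this
    cases α with
    | nil => rfl
    | cons a α => simp [size] at this

theorem conv_ext {k : Type*} [Field k] {φ φ' : WithConv (QSym k →ₗ[k] k)}
    (h : ∀ α, φ (M k α) = φ' (M k α)) : φ = φ' := by
  apply WithConv.ofConv_injective
  refine (basisM k).ext fun α => ?_
  rw [basisM_apply]
  exact h α

/-! ### The double filtration argument -/

/-- Convolution product of functions on pairs of compositions. -/
def pairConv {k : Type*} [Field k] (F G : List ℕ+ → List ℕ+ → k) (α β : List ℕ+) : k :=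
  ∑ i ∈ Finset.range (α.length + 1), ∑ j ∈ Finset.range (β.length + 1),
    F (α.take i) (β.take j) * G (α.drop i) (β.drop j)

open Finset in
-- Isolates the two extreme splittings, distinct because α and β are not both empty. All others
-- involve strictly shorter pairs on both sides.
theorem pairConv_eq_add {k : Type*} [Field k] (F G : List ℕ+ → List ℕ+ → k) {α β : List ℕ+}
    (h : α.length + β.length ≠ 0) :
    pairConv F G α β = F [] [] * G α β + F α β * G [] [] +
      ∑ x ∈ ((range (α.length + 1) ×ˢ range (β.length + 1)).erase (0, 0)).erase
        (α.length, β.length), F (α.take x.1) (β.take x.2) * G (α.drop x.1) (β.drop x.2) := by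
  rw [pairConv, ← sum_product', ← add_sum_erase _ _ (a := (0, 0)) (by simp),
    ← add_sum_erase ((range (α.length + 1) ×ˢ range (β.length + 1)).erase (0, 0)) _
      (a := (α.length, β.length)), add_assoc]
  · simp
  · simp only [mem_erase, ne_eq, Prod.mk.injEq, mem_product, mem_range]
    omega

open Finset in
theorem proper_split_lengths {α β : List ℕ+} {x : ℕ × ℕ}
    (hx : x ∈ ((range (α.length + 1) ×ˢ range (β.length + 1)).erase (0, 0)).erase
      (α.length, β.length)) :
    (α.take x.1).length + (β.take x.2).length < α.length + β.length ∧
      (α.drop x.1).length + (β.drop x.2).length < α.length + β.length := by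
  obtain ⟨i, j⟩ := x
  simp only [mem_erase, ne_eq, Prod.mk.injEq, mem_product, mem_range, List.length_take,
    List.length_drop] at hx ⊢
  omega

/-- By induction on total length, the only new unknown in F * G at (α, β) is G α β, with coefficient
F [] [] = 1. -/
theorem pairConv_left_cancel {k : Type*} [Field k] {F F' G G' : List ℕ+ → List ℕ+ → k}
    (hF : ∀ α β, F α β = F' α β) (hF1 : F [] [] = 1)
    (h : ∀ α β, pairConv F G α β = pairConv F' G' α β) (α β : List ℕ+) : G α β = G' α β := by
  obtain rfl : F = F' := funext₂ hF
  induction hn : α.length + β.length using Nat.strong_induction_on generalizing α β with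
  | _ n ih =>
    have h00 : G [] [] = G' [] [] := by simpa [pairConv, hF1] using h [] []
    rcases eq_or_ne n 0 with rfl | hn0
    · have h1 : α = [] := List.length_eq_zero_iff.1 (by omega)
      have h2 : β = [] := List.length_eq_zero_iff.1 (by omega)
      rw [h1, h2, h00]
    · have hαβ := h α β
      rw [pairConv_eq_add _ _ (by omega), pairConv_eq_add _ _ (by omega), h00, hF1, one_mul,
        one_mul, Finset.sum_congr rfl fun x hx => by
          rw [ih _ (hn ▸ (proper_split_lengths hx).2) _ _ rfl]] at hαβ
      linear_combination hαβ

/-- As for cancellation, but the new unknown occurs in both extreme terms, with total coefficient 2.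
-/
theorem pairConv_sqrt_unique {k : Type*} [Field k] (h2 : (2 : k) ≠ 0)
    {G G' : List ℕ+ → List ℕ+ → k} (hG : G [] [] = 1) (hG' : G' [] [] = 1)
    (h : ∀ α β, pairConv G G α β = pairConv G' G' α β) (α β : List ℕ+) : G α β = G' α β := by
  induction hn : α.length + β.length using Nat.strong_induction_on generalizing α β with
  | _ n ih =>
    rcases eq_or_ne n 0 with rfl | hn0
    · have h1 : α = [] := List.length_eq_zero_iff.1 (by omega)
      have h2 : β = [] := List.length_eq_zero_iff.1 (by omega)
      rw [h1, h2, hG, hG']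
    · have hαβ := h α β
      rw [pairConv_eq_add _ _ (by omega), pairConv_eq_add _ _ (by omega), hG, hG',
        Finset.sum_congr rfl fun x hx => by
          rw [ih _ (hn ▸ (proper_split_lengths hx).1) _ _ rfl,
            ih _ (hn ▸ (proper_split_lengths hx).2) _ _ rfl]] at hαβ
      apply mul_left_cancel₀ h2
      linear_combination hαβ

/-- `φ` is compatible with products of monomial functions. -/
def IsMulOnM {k : Type*} [Field k] (φ : WithConv (QSym k →ₗ[k] k)) : Prop :=
  ∀ α β, φ (M k α * M k β) = φ (M k α) * φ (M k β)

open Finset in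
theorem pairConv_mul_eq {k : Type*} [Field k] (φ φ' : WithConv (QSym k →ₗ[k] k))
    (α β : List ℕ+) :
    pairConv (fun α β => φ (M k α) * φ (M k β)) (fun α β => φ' (M k α) * φ' (M k β)) α β =
      (φ * φ') (M k α) * (φ * φ') (M k β) := by
  rw [pairConv, convMul_M, convMul_M, sum_mul_sum]
  exact sum_congr rfl fun i _ => sum_congr rfl fun j _ => mul_mul_mul_comm _ _ _ _

theorem IsMulOnM.convMul {k : Type*} [Field k] {φ φ' : WithConv (QSym k →ₗ[k] k)}
    (h : IsMulOnM φ) (h' : IsMulOnM φ') : IsMulOnM (φ * φ') := by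
  intro α β
  rw [← pairConv_mul_eq, convMul_M_mul_M]
  exact Finset.sum_congr rfl fun i _ => Finset.sum_congr rfl fun j _ => by rw [h, h']

/-- The functions φ(M_α M_β) and φ(M_α)φ(M_β) of a pair both turn convolution of functionals into
`pairConv`, so agreement for φ and for φφ' can be cancelled to agreement for φ'. -/
theorem IsMulOnM.of_convMul {k : Type*} [Field k] {φ φ' : WithConv (QSym k →ₗ[k] k)}
    (h : IsMulOnM φ) (h1 : φ 1 = 1) (h' : IsMulOnM (φ * φ')) : IsMulOnM φ' := by
  refine pairConv_left_cancel (F := fun α β => φ (M k α * M k β))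
    (F' := fun α β => φ (M k α) * φ (M k β)) (G := fun α β => φ' (M k α * M k β))
    (G' := fun α β => φ' (M k α) * φ' (M k β)) h (by simp [M_nil, h1]) fun α β => ?_
  rw [pairConv_mul_eq, ← h', convMul_M_mul_M]
  rfl

theorem IsMulOnM.of_convMul_self {k : Type*} [Field k] (h2 : (2 : k) ≠ 0)
    {φ : WithConv (QSym k →ₗ[k] k)} (h1 : φ 1 = 1) (h : IsMulOnM (φ * φ)) : IsMulOnM φ := by
  refine pairConv_sqrt_unique h2 (G := fun α β => φ (M k α * M k β))
    (G' := fun α β => φ (M k α) * φ (M k β)) (by simp [M_nil, h1]) (by simp [M_nil, h1])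
    fun α β => ?_
  rw [pairConv_mul_eq, ← h, convMul_M_mul_M]
  rfl

/-! ### The universal character and the conjugation are multiplicative -/

theorem zeta_M (k : Type*) [Field k] (α : List ℕ+) :
    zeta k (M k α) = if α.length ≤ 1 then 1 else 0 := by
  conv_lhs => rw [← basisM_apply]
  exact (basisM k).constr_basis k _ α

/-- The polynomial `f(X, 0, 0, …)`. -/
noncomputable def firstVariable (k : Type*) [Field k] : QSym k →ₗ[k] Polynomial k :=
  (basisM k).constr k fun α => if α.length ≤ 1 then Polynomial.X ^ size α else 0

theorem firstVariable_M (k : Type*) [Field k] (α : List ℕ+) :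
    firstVariable k (M k α) = if α.length ≤ 1 then Polynomial.X ^ size α else 0 := by
  conv_lhs => rw [← basisM_apply]
  exact (basisM k).constr_basis k _ α

theorem flat_single (n : ℕ) :
    flat (Finsupp.single 0 n) = if n = 0 then [] else [n.toPNat'] := by
  split_ifs with h
  · simp [h, flat]
  · simp [flat, Finsupp.support_single, h]

theorem flat_single_eq_iff (n : ℕ) (α : List ℕ+) :
    flat (Finsupp.single 0 n) = α ↔ α.length ≤ 1 ∧ n = size α := by
  rw [flat_single]
  rcases α with _ | ⟨a, _ | ⟨b, α⟩⟩
  · by_cases h : n = 0 <;> simp [h, size]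
  · by_cases h : n = 0
    · simp [h, size, a.ne_zero.symm]
    · simp only [h, if_false, List.cons.injEq, and_true, size]
      rw [← PNat.coe_inj, PNat.toPNat'_coe (Nat.pos_of_ne_zero h)]
      simp
  · by_cases h : n = 0 <;> simp [h]

theorem coeff_firstVariable {k : Type*} [Field k] (f : QSym k) (n : ℕ) :
    (firstVariable k f).coeff n =
      MvPowerSeries.coeff (Finsupp.single 0 n) (f : MvPowerSeries ℕ k) := by
  suffices h : Polynomial.lcoeff k n ∘ₗ firstVariable k =
      MvPowerSeries.coeff (Finsupp.single 0 n) ∘ₗ (QSym k).val.toLinearMap from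
    LinearMap.congr_fun h f
  refine (basisM k).ext fun α => ?_
  simp only [LinearMap.comp_apply, basisM_apply, Polynomial.lcoeff_apply, firstVariable_M,
    AlgHom.toLinearMap_apply, Subalgebra.coe_val, coeff_M, flat_single_eq_iff]
  by_cases h : α.length ≤ 1 <;> simp [h, Polynomial.coeff_X_pow]

/-- Monomials in one variable factor only into monomials in that variable, so setting the other
variables to 0 respects products. -/
theorem firstVariable_mul {k : Type*} [Field k] (f g : QSym k) :
    firstVariable k (f * g) = firstVariable k f * firstVariable k g := by
  ext n
  rw [coeff_firstVariable, MulMemClass.coe_mul, MvPowerSeries.coeff_mul, Polynomial.coeff_mul,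
    Finsupp.antidiagonal_single, Finset.sum_map]
  exact Finset.sum_congr rfl fun p _ => by rw [coeff_firstVariable, coeff_firstVariable]; rfl

theorem zeta_eq_eval {k : Type*} [Field k] (f : QSym k) :
    zeta k f = (firstVariable k f).eval 1 := by
  suffices h : zeta k = Polynomial.leval 1 ∘ₗ firstVariable k from LinearMap.congr_fun h f
  refine (basisM k).ext fun α => ?_
  simp only [LinearMap.comp_apply, basisM_apply, zeta_M, firstVariable_M, Polynomial.leval_apply]
  split_ifs <;> simp

theorem zeta_mul {k : Type*} [Field k] (f g : QSym k) : zeta k (f * g) = zeta k f * zeta k g := by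
  rw [zeta_eq_eval, firstVariable_mul, Polynomial.eval_mul, ← zeta_eq_eval, ← zeta_eq_eval]

theorem conj_mul {k : Type*} [Field k] (f g : QSym k) : conj k (f * g) = conj k f * conj k g := by
  refine Subtype.ext (MvPowerSeries.ext fun d => ?_)
  rw [MulMemClass.coe_mul]
  change MvPowerSeries.coeff d (conjSeries (f.1 * g.1)) =
    MvPowerSeries.coeff d (conjSeries f.1 * conjSeries g.1)
  rw [coeff_conjSeries, MvPowerSeries.coeff_mul, MvPowerSeries.coeff_mul, Finset.mul_sum]
  refine Finset.sum_congr rfl fun p hp => ?_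
  rw [Finset.HasAntidiagonal.mem_antidiagonal] at hp
  rw [coeff_conjSeries, coeff_conjSeries, ← hp, map_add, pow_add, mul_mul_mul_comm]

theorem conj_M {k : Type*} [Field k] (α : List ℕ+) : conj k (M k α) = ((-1) ^ size α : k) • M k α := by
  refine Subtype.ext (MvPowerSeries.ext fun d => ?_)
  change MvPowerSeries.coeff d (conjSeries (M k α).1) = _
  rw [coeff_conjSeries, Subalgebra.coe_smul, MvPowerSeries.coeff_smul, degree_eq_size_flat, coeff_M]
  split_ifs with h
  · rw [h]
  · simp

theorem barFunctional_M {k : Type*} [Field k] (φ : QSym k →ₗ[k] k) (α : List ℕ+) :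
    barFunctional φ (M k α) = (-1) ^ size α * φ (M k α) := by
  rw [barFunctional, LinearMap.comp_apply, conj_M, map_smul, smul_eq_mul]

open Finset WithConv in
theorem barFunctional_convMul {k : Type*} [Field k] (φ φ' : QSym k →ₗ[k] k) :
    toConv (barFunctional (toConv φ * toConv φ').ofConv) =
      toConv (barFunctional φ) * toConv (barFunctional φ') := by
  refine conv_ext fun α => ?_
  rw [convMul_M]
  change barFunctional (toConv φ * toConv φ').ofConv (M k α) = ∑ i ∈ range (α.length + 1),
    barFunctional φ (M k (α.take i)) * barFunctional φ' (M k (α.drop i))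
  rw [barFunctional_M]
  change _ * (toConv φ * toConv φ') (M k α) = _
  rw [convMul_M, mul_sum]
  refine sum_congr rfl fun i _ => ?_
  rw [barFunctional_M, barFunctional_M]
  conv_lhs => rw [← List.take_append_drop i α]
  rw [size_append, pow_add]
  simp only [List.take_append_drop]
  exact mul_mul_mul_comm _ _ _ _

theorem isEvenFunctional_iff {k : Type*} [Field k] (φ : QSym k →ₗ[k] k) :
    IsEvenFunctional φ ↔ ∀ α, (-1) ^ size α * φ (M k α) = φ (M k α) := by
  constructor
  · intro h α
    rw [← barFunctional_M, h]
  · intro h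
    refine (basisM k).ext fun α => ?_
    rw [basisM_apply, barFunctional_M, h]

theorem convOne_M (k : Type*) [Field k] (α : List ℕ+) :
    (1 : WithConv (QSym k →ₗ[k] k)) (M k α) = if α = [] then 1 else 0 := by
  rw [LinearMap.convOne_apply]
  exact counit_M k α

/-! ### Existence of the decomposition -/

/-- The odd part of the universal character. -/
noncomputable def oddPart (k : Type*) [Field k] : QSym k →ₗ[k] k :=
  (basisM k).constr k (oddValue k)

theorem oddPart_M (k : Type*) [Field k] (α : List ℕ+) : oddPart k (M k α) = oddValue k α := by
  conv_lhs => rw [← basisM_apply]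
  exact (basisM k).constr_basis k _ α

/-- The even part of the universal character. -/
noncomputable def evenPart (k : Type*) [Field k] : QSym k →ₗ[k] k :=
  (WithConv.toConv (zeta k) * WithConv.toConv (barFunctional (oddPart k))).ofConv

open WithConv Finset in
theorem isOddFunctional_oddPart {k : Type*} [Field k] (h2 : (2 : k) ≠ 0) :
    IsOddFunctional (oddPart k) := by
  constructor
  · refine conv_ext fun α => ?_
    rw [convMul_M, convOne_M, ← sum_oddValue_mul h2]
    refine sum_congr rfl fun i _ => ?_
    rw [← oddPart_M, ← oddPart_M, ← barFunctional_M]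
  · refine conv_ext fun α => ?_
    rw [convMul_M, convOne_M, ← sum_mul_oddValue h2]
    refine sum_congr rfl fun i _ => ?_
    rw [← oddPart_M, ← oddPart_M, ← barFunctional_M]

open WithConv in
-- In ζψ̄ only the prefixes of length 0 and 1 survive, since ζ vanishes on longer ones and is 1 on
-- these.
theorem evenPart_M_cons (k : Type*) [Field k] (a : ℕ+) (α : List ℕ+) :
    evenPart k (M k (a :: α)) =
      (-1) ^ size (a :: α) * oddValue k (a :: α) + (-1) ^ size α * oddValue k α := by
  have h : evenPart k (M k (a :: α)) = ∑ i ∈ Finset.range ((a :: α).length + 1),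
      zeta k (M k ((a :: α).take i)) * ((-1) ^ size ((a :: α).drop i) *
        oddValue k ((a :: α).drop i)) := by
    change (toConv (zeta k) * toConv (barFunctional (oddPart k))) (M k (a :: α)) = _
    rw [convMul_M]
    refine Finset.sum_congr rfl fun i _ => ?_
    rw [← oddPart_M, ← barFunctional_M]
  rw [h, List.length_cons, Finset.sum_range_succ', Finset.sum_range_succ', Finset.sum_eq_zero]
  · simp [zeta_M, add_comm]
  · intro i hi
    rw [Finset.mem_range] at hi
    rw [zeta_M, if_neg, zero_mul]
    simp only [List.length_take, List.length_cons]
    omega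

theorem evenPart_one (k : Type*) [Field k] : evenPart k 1 = 1 := by
  change (WithConv.toConv (zeta k) * WithConv.toConv (barFunctional (oddPart k))) 1 = 1
  rw [← M_nil, convMul_M]
  simp only [List.length_nil, zero_add, Finset.sum_range_one, List.take_nil, List.drop_nil]
  change zeta k (M k []) * barFunctional (oddPart k) (M k []) = 1
  rw [zeta_M, barFunctional_M, oddPart_M]
  simp [size]

theorem oddPart_one (k : Type*) [Field k] : oddPart k 1 = 1 := by
  rw [← M_nil, oddPart_M, oddValue_nil]

/-! ### Closed formulas on the monomial basis -/

theorem oddValue_eq {k : Type*} [Field k] {α : List ℕ+} (hα : α ≠ []) :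
    oddValue k α = if Odd (α.getLast hα : ℕ) then
      (-1) ^ numEven α / 2 ^ (2 * (numOdd α / 2)) * (bivariateCatalan 0 (numOdd α / 2) : k)
      else 0 := by
  have hE : EndsOdd α ↔ Odd (α.getLast hα : ℕ) := ⟨fun h => h hα, fun h _ => h⟩
  rw [oddValue]
  split_ifs with h1 h2 h2
  · rw [bivariateCatalan_zero_left, sqrtCoeff, pow_mul, show (2 : k) ^ 2 = 4 by norm_num,
      div_mul_eq_mul_div, mul_div_assoc]
  · exact (h2 (hE.1 h1)).elim
  · exact (h1 (hE.2 h2)).elim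
  · rfl

theorem sqrtCoeff_sub {k : Type*} [Field k] (h2 : (2 : k) ≠ 0) (m : ℕ) :
    sqrtCoeff k (2 * (m + 1)) - sqrtCoeff k (2 * m) =
      -(bivariateCatalan 1 m : k) / 2 ^ (2 * (m + 1)) := by
  have h := congrArg (Int.cast : ℤ → k) (centralBinom_sub_eq m)
  push_cast at h
  have h4 := pow_ne_zero m (four_ne_zero' h2)
  have h4' := four_ne_zero' h2
  rw [← h, sqrtCoeff, sqrtCoeff, Nat.mul_div_cancel_left _ two_pos,
    Nat.mul_div_cancel_left _ two_pos, pow_mul, show (2 : k) ^ 2 = 4 by norm_num, pow_succ]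
  field_simp
  ring

/-- In the first case `numOdd α` is positive and even, hence at least 2, so the subtraction of 1 is
not truncated. -/
theorem evenPart_M {k : Type*} [Field k] (h2 : (2 : k) ≠ 0) {α : List ℕ+} (hα : α ≠ []) :
    evenPart k (M k α) =
      if Odd (α.head hα : ℕ) ∧ Odd (α.getLast hα : ℕ) ∧ Even (size α) then
        (-1) ^ (numEven α + 1) / 2 ^ numOdd α * (bivariateCatalan 1 (numOdd α / 2 - 1) : k)
      else if α.length = 1 ∧ Even (size α) then 1
      else 0 := by
  obtain ⟨a, α, rfl⟩ := List.exists_cons_of_ne_nil hα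
  rw [evenPart_M_cons, List.head_cons]
  rcases eq_or_ne α [] with rfl | hne
  · rcases Nat.even_or_odd (a : ℕ) with ha | ha
    · simp [oddValue, EndsOdd, size, numEven, numOdd, ha, Nat.not_odd_iff_even.2 ha]
    · have ha' := Nat.not_even_iff_odd.2 ha
      simp [oddValue, EndsOdd, size, ha, ha', numEven, numOdd, sqrtCoeff,
        ha.neg_one_pow]
  have hlast : (a :: α).getLast hα = α.getLast hne := List.getLast_cons hne
  have hlen : (a :: α).length ≠ 1 := by simpa using hne
  rw [hlast, if_neg (c := (a :: α).length = 1 ∧ _) fun h => hlen h.1]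
  by_cases hl : Odd (α.getLast hne : ℕ)
  swap
  · have h1 : ¬ EndsOdd α := fun h => hl (h hne)
    have h2 : ¬ EndsOdd (a :: α) := fun h => hl (hlast ▸ h hα)
    simp [oddValue, h1, h2, hl]
  have h1 : EndsOdd α := fun _ => hl
  have h1' : EndsOdd (a :: α) := fun _ => hlast ▸ hl
  rw [oddValue, oddValue, if_pos h1, if_pos h1', neg_one_pow_size, neg_one_pow_size]
  have hO : numOdd (a :: α) = numOdd α + if Odd (a : ℕ) then 1 else 0 := by
    by_cases h : Odd (a : ℕ) <;> simp [numOdd, h]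
  have hE : numEven (a :: α) = numEven α + if Even (a : ℕ) then 1 else 0 := by
    by_cases h : Even (a : ℕ) <;> simp [numEven, h]
  rcases Nat.even_or_odd (a : ℕ) with ha | ha
  -- An even first part only flips (-1)^{k_e}, so the two terms cancel.
  · have ha' := Nat.not_odd_iff_even.2 ha
    rw [hO, hE, if_pos ha, if_neg ha', if_neg fun h => ha' h.1, add_zero]
    ring
  have ha' := Nat.not_even_iff_odd.2 ha
  -- The sign identity is read over ℚ, where -1 ≠ 1, to compare parities.
  have hpar : Even (size (a :: α)) ↔ Even (numOdd α + 1) := by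
    have h := neg_one_pow_size (k := ℚ) (a :: α)
    rw [hO, if_pos ha] at h
    rw [← neg_one_pow_eq_one_iff_even (R := ℚ) (by norm_num), h,
      neg_one_pow_eq_one_iff_even (by norm_num)]
  rw [hO, hE, if_neg ha', if_pos ha, add_zero]
  simp only [hpar, ha, hl, true_and]
  rcases Nat.even_or_odd' (numOdd α) with ⟨m, hm | hm⟩
  -- Odd total degree: c_{2m+1} = c_{2m} with opposite signs.
  · rw [hm, sqrtCoeff_odd, if_neg (Nat.not_even_iff_odd.2 (odd_two_mul_add_one m))]
    ring
  · have h := sqrtCoeff_sub h2 m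
    rw [hm, show 2 * m + 1 + 1 = 2 * (m + 1) by ring, if_pos (even_two_mul _), sqrtCoeff_odd,
      Nat.mul_div_cancel_left _ two_pos, Nat.add_sub_cancel, (even_two_mul _).neg_one_pow,
      (odd_two_mul_add_one m).neg_one_pow]
    linear_combination (-1) ^ numEven α * h

theorem isEvenFunctional_evenPart {k : Type*} [Field k] (h2 : (2 : k) ≠ 0) :
    IsEvenFunctional (evenPart k) := by
  rw [isEvenFunctional_iff]
  intro α
  rcases eq_or_ne α [] with rfl | hα
  · simp [size]
  rcases Nat.even_or_odd (size α) with h | h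
  · rw [h.neg_one_pow, one_mul]
  · have h' := Nat.not_even_iff_odd.2 h
    rw [evenPart_M h2 hα]
    simp [h']

open WithConv in
theorem isEvenOddDecomposition_zeta {k : Type*} [Field k] (h2 : (2 : k) ≠ 0) :
    IsEvenOddDecomposition (zeta k) (evenPart k) (oddPart k) where
  even_map_one := evenPart_one k
  odd_map_one := oddPart_one k
  even := isEvenFunctional_evenPart h2
  odd := isOddFunctional_oddPart h2
  eq_mul := by
    rw [evenPart, toConv_ofConv, mul_assoc, (isOddFunctional_oddPart h2).2, mul_one]

/-! ### The parts are characters -/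

open WithConv in
theorem IsMulOnM.bar {k : Type*} [Field k] {φ : QSym k →ₗ[k] k}
    (h : ∀ f g, φ (f * g) = φ f * φ g) : IsMulOnM (toConv (barFunctional φ)) := by
  intro α β
  change φ (conj k (M k α * M k β)) = φ (conj k (M k α)) * φ (conj k (M k β))
  rw [conj_mul, h]

theorem IsMulOnM.map_mul {k : Type*} [Field k] {φ : QSym k →ₗ[k] k}
    (h : IsMulOnM (WithConv.toConv φ)) (f g : QSym k) : φ (f * g) = φ f * φ g := by
  suffices H : (LinearMap.mul k (QSym k)).compr₂ φ = (LinearMap.mul k k).compl₁₂ φ φ from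
    LinearMap.congr_fun₂ H f g
  refine (basisM k).ext fun α => (basisM k).ext fun β => ?_
  simp only [basisM_apply]
  exact h α β

open WithConv in
/-- In a decomposition `φ = ρψ`, the odd part satisfies `φ̄ψ² = φ`. -/
theorem IsEvenOddDecomposition.bar_mul_sq {k : Type*} [Field k] {φ ρ ψ : QSym k →ₗ[k] k}
    (h : IsEvenOddDecomposition φ ρ ψ) :
    toConv (barFunctional φ) * (toConv ψ * toConv ψ) = toConv φ := by
  -- Conjugation respects convolution and fixes ρ; then φ̄ψ² = ρ(ψ̄ψ)ψ = ρψ.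
  have hb : toConv (barFunctional φ) = toConv ρ * toConv (barFunctional ψ) := by
    have := barFunctional_convMul ρ ψ
    rwa [← h.eq_mul, h.even] at this
  rw [hb, mul_assoc, ← mul_assoc (toConv (barFunctional ψ)), h.odd.2, one_mul, h.eq_mul]

open WithConv in
theorem isMulOnM_oddPart {k : Type*} [Field k] (h2 : (2 : k) ≠ 0) :
    IsMulOnM (toConv (oddPart k)) := by
  refine IsMulOnM.of_convMul_self h2 (oddPart_one k) ?_
  refine IsMulOnM.of_convMul (IsMulOnM.bar (zeta_mul (k := k))) ?_ ?_
  · change barFunctional (zeta k) 1 = 1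
    rw [← M_nil, barFunctional_M, zeta_M]
    simp [size]
  · rw [(isEvenOddDecomposition_zeta h2).bar_mul_sq]
    exact fun α β => zeta_mul _ _

theorem isMulOnM_evenPart {k : Type*} [Field k] (h2 : (2 : k) ≠ 0) :
    IsMulOnM (WithConv.toConv (evenPart k)) :=
  IsMulOnM.convMul (fun _ _ => zeta_mul _ _) (IsMulOnM.bar (isMulOnM_oddPart h2).map_mul)

/-! ### Uniqueness -/

open WithConv in
-- The relation φ̄ψ² = φ determines ψ², and the normalization ψ(1) = 1 then fixes the square root.
-- The one-variable statement is recovered from the pair version by taking β empty.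
theorem IsEvenOddDecomposition.odd_unique {k : Type*} [Field k] (h2 : (2 : k) ≠ 0)
    {φ ρ ψ ρ' ψ' : QSym k →ₗ[k] k} (hφ : φ 1 = 1) (h : IsEvenOddDecomposition φ ρ ψ)
    (h' : IsEvenOddDecomposition φ ρ' ψ') : ψ = ψ' := by
  have hbar : barFunctional φ (M k []) = 1 := by
    rw [barFunctional_M, M_nil, hφ]
    simp [size]
  have hsq := pairConv_left_cancel (F := fun α β => barFunctional φ (M k α) * barFunctional φ (M k β))
    (G := fun α β => (toConv ψ * toConv ψ) (M k α) * (toConv ψ * toConv ψ) (M k β))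
    (G' := fun α β => (toConv ψ' * toConv ψ') (M k α) * (toConv ψ' * toConv ψ') (M k β))
    (fun _ _ => rfl) (by rw [hbar, mul_one]) fun α β =>
      (pairConv_mul_eq (toConv (barFunctional φ)) (toConv ψ * toConv ψ) α β).trans <| by
        rw [h.bar_mul_sq, ← h'.bar_mul_sq]
        exact (pairConv_mul_eq (toConv (barFunctional φ)) (toConv ψ' * toConv ψ') α β).symm
  have hval := pairConv_sqrt_unique h2 (G := fun α β => ψ (M k α) * ψ (M k β))
    (G' := fun α β => ψ' (M k α) * ψ' (M k β))
    (by simp [M_nil, h.odd_map_one]) (by simp [M_nil, h'.odd_map_one]) fun α β =>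
      (pairConv_mul_eq (toConv ψ) (toConv ψ) α β).trans <|
        (hsq α β).trans (pairConv_mul_eq (toConv ψ') (toConv ψ') α β).symm
  refine (basisM k).ext fun α => ?_
  simpa [M_nil, h.odd_map_one, h'.odd_map_one] using hval α []

open WithConv in
theorem IsEvenOddDecomposition.even_eq {k : Type*} [Field k] {φ ρ ψ : QSym k →ₗ[k] k}
    (h : IsEvenOddDecomposition φ ρ ψ) :
    toConv ρ = toConv φ * toConv (barFunctional ψ) := by
  rw [h.eq_mul, mul_assoc, h.odd.1, mul_one]

theorem zeta_one (k : Type*) [Field k] : zeta k 1 = 1 := by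
  rw [← M_nil, zeta_M]
  simp

end QSymm

/-- Let `k` be a field of characteristic different from `2`. The universal character `ζ` of `QSym`
has a unique even part `ζ₊` and a unique odd part `ζ₋`; they are characters, and their values on
the monomial basis are as stated. -/
theorem theoremT (k : Type*) [Field k] (h2 : (2 : k) ≠ 0) :
    ∃ ζp ζm : QSymm.QSym k →ₐ[k] k,
      QSymm.IsEvenOddDecomposition (QSymm.zeta k) ζp.toLinearMap ζm.toLinearMap ∧
      (∀ ρ ψ : QSymm.QSym k →ₗ[k] k, QSymm.IsEvenOddDecomposition (QSymm.zeta k) ρ ψ →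
        ρ = ζp.toLinearMap ∧ ψ = ζm.toLinearMap) ∧
      (∀ (n : ℕ) (α : List ℕ+) (hα : α ≠ []), QSymm.size α = n →
        ζm (QSymm.M k α) =
          (if Odd (α.getLast hα : ℕ) then
            (-1) ^ QSymm.numEven α / 2 ^ (2 * (QSymm.numOdd α / 2)) *
              (QSymm.bivariateCatalan 0 (QSymm.numOdd α / 2) : k)
          else 0) ∧
        ζp (QSymm.M k α) =
          (if Odd (α.head hα : ℕ) ∧ Odd (α.getLast hα : ℕ) ∧ Even n then
            (-1) ^ (QSymm.numEven α + 1) / 2 ^ QSymm.numOdd α *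
              (QSymm.bivariateCatalan 1 (QSymm.numOdd α / 2 - 1) : k)
          else if α.length = 1 ∧ Even n then 1
          else 0)) ∧
      ζm 1 = 1 ∧ ζp 1 = 1 := by
  refine ⟨AlgHom.ofLinearMap (QSymm.evenPart k) (QSymm.evenPart_one k)
      (QSymm.isMulOnM_evenPart h2).map_mul,
    AlgHom.ofLinearMap (QSymm.oddPart k) (QSymm.oddPart_one k)
      (QSymm.isMulOnM_oddPart h2).map_mul,
    QSymm.isEvenOddDecomposition_zeta h2, ?_, ?_, map_one _, map_one _⟩
  · intro ρ ψ h
    have hψ : ψ = QSymm.oddPart k :=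
      h.odd_unique h2 (QSymm.zeta_one k) (QSymm.isEvenOddDecomposition_zeta h2)
    subst hψ
    exact ⟨WithConv.toConv_injective
      (h.even_eq.trans (QSymm.isEvenOddDecomposition_zeta h2).even_eq.symm), rfl⟩
  · rintro n α hα rfl
    exact ⟨(QSymm.oddPart_M k α).trans (QSymm.oddValue_eq hα), QSymm.evenPart_M h2 hα⟩
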